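/- Let $x_1,\dots,x_n\in\mathbb R^d$ be vectors such that the cone $C=\operatorname{cone}(x_1,\dots,x_n)=\mathbb R_+x_1+\dots+\mathbb R_+x_n$ is full-dimensional, $\dim C=d$. *Visibility.* Given $y_1,\dots,y_m$, a subset $S$ of $\operatorname{cone}(y_1,\dots,y_{m-1})$ is *visible from* $y_m$ if $y_m\notin\operatorname{cone}(y_1,\dots,y_{m-1})$ and for every $y\in S$ the segment $[y_m,y]$ meets $\operatorname{cone}(y_1,\dots,y_{m-1})$ only in $y$. For a cone $S$ write $\operatorname{cone}(S,y)=S+\mathbb R_+y$. *Lexicographic triangulation.* $\Lambda(y_1,\dots,y_m)$ is the set of cones defined recursively by $\Lambda()=\{\{0\}\}$ and $$\Lambda(y_1,\dots,y_m)=\Lambda(y_1,\dots,y_{m-1})\cup\{\operatorname{cone}(\sigma,y_m):\sigma\in\Lambda(y_1,\dots,y_{m-1})\text{ visible from }y_m\}.$$ *Pyramid decomposition.* For a system $y_1,\dots,y_m$ of rank $e$ whose first $e$ members are linearly independent, $\Pi(y_1,\dots,y_m)$ is the set of cones defined recursively by $\Pi()=\{\{0\}\}$ and $$\Pi(y_1,\dots,y_m)=\Pi(y_1,\dots,y_{m-1})\cup\{\operatorname{cone}(F,y_m):F\text{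 a face of }\operatorname{cone}(y_1,\dots,y_{m-1})\text{ visible from }y_m\},$$ where $\operatorname{cone}(y_1,\dots,y_{m-1})$ counts as a face of itself. For an arbitrary system of rank $e$ one first rearranges it as $y_{i_1},\dots,y_{i_e},y_{j_1},\dots,y_{j_{m-e}}$, where $(i_1,\dots,i_e)$ is the lexicographically smallest index vector of a linearly independent subsystem of $e$ members and $j_1<\dots<j_{m-e}$ are the other indices, and sets $\Pi(y_1,\dots,y_m)=\Pi(y_{i_1},\dots,y_{i_e},y_{j_1},\dots,y_{j_{m-e}})$. *Iteration.* Let $\Pi^0(x_1,\dots,x_n)=\Pi(x_1,\dots,x_n)$ and $$\Pi^k(x_1,\dots,x_n)=\bigcup_{P\in\Pi^{k-1}(x_1,\dots,x_n)}\Pi(x_i:x_i\in P)\qquad(k>0),$$ where $(x_i:x_i\in P)$ is taken in the order of increasing indices. Let $\Pi^\infty(x_1,\dots,x_n)$ be the set of all cones that belong to $\Pi^k(x_1,\dots,x_n)$ for all sufficiently large $k$. Then $$\Pi^\infty(x_1,\dots,x_n)=\Pi^{n-d}(x_1,\dots,x_n)=\Lambda(x_1,\dots,x_n),$$ and $\Pi^k(x_1,\dots,x_n)=\Pi^{n-d}(x_1,\dots,x_n)$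 for all $k\ge n-d$. -/

import Mathlib

noncomputable section

namespace PyramidDecomposition

/-! Finite ordered systems `x₁, …, xₙ` of vectors are lists; cones are convex cones that contain
the origin (`PointedCone ℝ E`, which in Mathlib's sense may contain lines). -/

variable {E : Type*} [AddCommGroup E] [Module ℝ E]

/-- `cone(x₁, …, xₙ) = ℝ₊x₁ + ⋯ + ℝ₊xₙ`, for the system `l = [x₁, …, xₙ]`. -/
def cone (l : List E) : PointedCone ℝ E :=
  PointedCone.hull ℝ {v | v ∈ l}

/-- `cone(S, v) = S + ℝ₊v`. -/
def coneOver (S : PointedCone ℝ E) (v : E) : PointedCone ℝ E :=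
  S ⊔ PointedCone.hull ℝ {v}

/-- The dimension of a cone: the dimension of the linear subspace that it spans. -/
def coneDim (C : PointedCone ℝ E) : ℕ :=
  Module.finrank ℝ (Submodule.span ℝ (C : Set E))

/-- The subcone `S` of `C` is visible from `v`: the point `v` does not belong to `C`, and for every
point `y` of `S` the line segment `[v, y]` meets `C` only in `y`. -/
def IsVisible (C : PointedCone ℝ E) (v : E) (S : PointedCone ℝ E) : Prop :=
  v ∉ C ∧ ∀ y ∈ S, segment ℝ v y ∩ (C : Set E) = {y}

/-- Lexicographic triangulation, for a system listed with its last vector first. -/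
def lexTriangulationRev : List E → Set (PointedCone ℝ E)
  | [] => {⊥}
  | v :: l => lexTriangulationRev l ∪
      {P | ∃ σ ∈ lexTriangulationRev l, IsVisible (cone l) v σ ∧ P = coneOver σ v}

/-- The lexicographic (placing) triangulation `Λ(x₁, …, xₙ)`, as the set of all its cones (of all
dimensions). It is the zero cone for `n = 0`, and `Λ(x₁, …, xₙ)` consists of the members of
`Λ(x₁, …, xₙ₋₁)` and of the cones `cone(σ, xₙ)`, for `σ` in `Λ(x₁, …, xₙ₋₁)` visible from `xₙ`. -/
def lexTriangulation (l : List E) : Set (PointedCone ℝ E) :=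
  lexTriangulationRev l.reverse

/-- Pyramid decomposition, for a system listed with its last vector first. -/
def pyramidDecRev : List E → Set (PointedCone ℝ E)
  | [] => {⊥}
  | v :: l => pyramidDecRev l ∪
      {P | ∃ F : PointedCone ℝ E, F.IsFaceOf (cone l) ∧ IsVisible (cone l) v F ∧ P = coneOver F v}

open Classical in
/-- The vectors of a system that are not in the span of `V` and the vectors before them. -/
def basisPart : Submodule ℝ E → List E → List E
  | _, [] => []
  | V, v :: l => if v ∈ V then basisPart V l else v :: basisPart (V ⊔ Submodule.span ℝ {v}) l

open Classical in
/-- The vectors of a system that are in the span of `V` and the vectors before them. -/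
def redundantPart : Submodule ℝ E → List E → List E
  | _, [] => []
  | V, v :: l =>
      if v ∈ V then v :: redundantPart V l else redundantPart (V ⊔ Submodule.span ℝ {v}) l

/-- The arrangement `x_{i₁}, …, x_{iₑ}, x_{j₁}, …, x_{jₙ₋ₑ}` of a system `x₁, …, xₙ` of rank `e`,
where `(i₁, …, iₑ)` is the lexicographically smallest index vector of a linearly independent
subsystem of `e` vectors, and `j₁ < ⋯ < jₙ₋ₑ` are the other indices. The index `i` is one of the
`i₁, …, iₑ` if and only if `xᵢ` is not in the span of `x₁, …, xᵢ₋₁`. -/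
def arrange (l : List E) : List E :=
  basisPart ⊥ l ++ redundantPart ⊥ l

/-- The pyramid decomposition `Π(x₁, …, xₙ)`, as a set of cones. It follows the convention that a
system is first arranged so that it begins with a basis of its span (nothing is changed if it
already does). For an arranged system, `Π(x₁, …, xₙ)` consists of the members of
`Π(x₁, …, xₙ₋₁)` and of the pyramids `cone(F, xₙ)`, for `F` a face of `cone(x₁, …, xₙ₋₁)` visible
from `xₙ`; it is the zero cone for `n = 0`. -/
def pyramidDec (l : List E) : Set (PointedCone ℝ E) :=
  pyramidDecRev (arrange l).reverse

open Classical in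
/-- The subsystem `(xᵢ : xᵢ ∈ P)`, in the order of the given system. -/
def subsystem (l : List E) (P : PointedCone ℝ E) : List E :=
  l.filter (fun v => decide (v ∈ P))

/-- The iterated pyramid decomposition: `Π⁰(x₁, …, xₙ) = Π(x₁, …, xₙ)`, and `Πᵏ⁺¹(x₁, …, xₙ)` is the
union of the pyramid decompositions `Π(xᵢ : xᵢ ∈ P)` over all `P` in `Πᵏ(x₁, …, xₙ)`. -/
def pyramidIter (l : List E) : ℕ → Set (PointedCone ℝ E)
  | 0 => pyramidDec l
  | k + 1 => ⋃ P ∈ pyramidIter l k, pyramidDec (subsystem l P)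

/-- The total pyramid decomposition `Π^∞(x₁, …, xₙ)`: the pyramids that belong to
`Πᵏ(x₁, …, xₙ)` for all sufficiently large `k`. -/
def pyramidTotal (l : List E) : Set (PointedCone ℝ E) :=
  {P | ∀ᶠ k in Filter.atTop, P ∈ pyramidIter l k}

theorem arrange_aux_of_mem (V : Submodule ℝ E) (l : List E) (h : ∀ v ∈ l, v ∈ V) :
    basisPart V l = [] ∧ redundantPart V l = l := by
  induction l with
  | nil => simp [basisPart, redundantPart]
  | cons v l ih =>
    have hv : v ∈ V := h v (by simp)
    have := ih (fun w hw => h w (by simp [hw]))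
    simp [basisPart, redundantPart, hv, this]

theorem arrange_aux_append (b c r : List E)
    (hb : LinearIndependent ℝ (fun i : Fin (b ++ c).length => (b ++ c).get i))
    (hr : ∀ v ∈ r, v ∈ Submodule.span ℝ {w | w ∈ b ++ c}) :
    basisPart (Submodule.span ℝ {w | w ∈ b}) (c ++ r) = c ∧
      redundantPart (Submodule.span ℝ {w | w ∈ b}) (c ++ r) = r := by
  induction c generalizing b with
  | nil =>
    rw [List.append_nil] at hr
    simpa using arrange_aux_of_mem _ r hr
  | cons v c ih =>
    have hlt : b.length < (b ++ v :: c).length := by simp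
    have hv : v ∉ Submodule.span ℝ {w | w ∈ b} := by
      have h := hb.notMem_span_image (s := {i | i.1 < b.length})
        (x := ⟨b.length, hlt⟩) (by simp)
      simp only [List.get_eq_getElem, List.getElem_append_right (le_refl b.length),
        Nat.sub_self, List.getElem_cons_zero] at h
      intro hmem
      refine h (Submodule.span_mono ?_ hmem)
      intro w hw
      obtain ⟨i, hi, rfl⟩ := List.mem_iff_getElem.1 hw
      exact ⟨⟨i, hi.trans hlt⟩, hi, by simp [List.getElem_append_left hi]⟩
    have hs : Submodule.span ℝ {w | w ∈ b} ⊔ Submodule.span ℝ {v} =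
        Submodule.span ℝ {w | w ∈ b ++ [v]} := by
      rw [← Submodule.span_union]
      congr 1
      ext w
      simp [or_comm]
    have e : b ++ v :: c = (b ++ [v]) ++ c := by simp
    rw [e] at hb hr
    have := ih (b ++ [v]) hb hr
    rw [List.cons_append, basisPart, redundantPart, if_neg hv, if_neg hv, hs, this.1, this.2]
    exact ⟨rfl, rfl⟩

/-- A system that begins with a basis of its span is not changed by `arrange`. -/
theorem arrange_eq_self (b r : List E)
    (hb : LinearIndependent ℝ (fun i : Fin b.length => b.get i))
    (hr : ∀ v ∈ r, v ∈ Submodule.span ℝ {w | w ∈ b}) :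
    arrange (b ++ r) = b ++ r := by
  have := arrange_aux_append [] b r hb hr
  simp only [List.not_mem_nil, Set.ofPred_false, Submodule.span_empty] at this
  rw [arrange, this.1, this.2]

end PyramidDecomposition

end

/-! The idea is to compare one step of pyramid decomposition with the lexicographic triangulation
`Λ`, and to count how many steps are needed.

*Visibility.* A subcone `S` of `C` is visible from `v` if and only if `v + y ∉ C` for all `y ∈ S`
(`isVisible_iff`). It follows that the pyramid over `S` with apex `v` meets `C` only in `S`, that
`v` is not in the span of `S`, and that the smallest face of `C` containing `S` is visible as soon
as `S` is (`IsVisible.faceHull`).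

*No rearrangement.* A vector outside the span of all the others can be moved past its neighbours
without changing the set of pyramids. So the decomposition of a system may be computed in the given
order, by the recursion `pyramidRec`: a vector outside the span of the preceding ones is put on top
of all pyramids found so far, any other vector on top of the visible faces
(`pyramidDec_eq_pyramidRec`). This order is compatible with the passage to subsystems.

*One step.* `Λ` restricts to the faces of the cone (`mem_lexTriangulationRev_subsystem_iff`), and a
member of `Λ` is visible if and only if it lies in a visible face. Hence the lexicographic
triangulation of a system is the union of those of its pyramids
(`mem_lexTriangulationRev_iff_exists_pyramidRec`).

*Counting.* The excess of a system is the number of its vectors that lie in the span, but not in the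
cone, of the preceding vectors. A system of excess `0` has the same pyramids as cones in `Λ`. The
passage to a pyramid lowers a positive excess: faces have at most the excess of the whole system,
and an apex over a visible face is outside the span of that face
(`excess_subsystem_of_mem_pyramidRec`). The excess of `n` vectors of rank `d` is at most `n - d`, so
that all iterates from `Π^(n-d)` on are equal to `Λ`. -/

noncomputable section

namespace PyramidDecomposition

variable {E : Type*} [AddCommGroup E] [Module ℝ E]

/-! ### Cones and visibility -/

theorem mem_coneOver {S : PointedCone ℝ E} {v x : E} :
    x ∈ coneOver S v ↔ ∃ y ∈ S, ∃ t : ℝ, 0 ≤ t ∧ y + t • v = x := by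
  simp only [coneOver, Submodule.mem_sup, Submodule.mem_span_singleton]
  constructor
  · rintro ⟨y, hy, z, ⟨a, rfl⟩, rfl⟩
    exact ⟨y, hy, a, a.2, rfl⟩
  · rintro ⟨y, hy, t, ht, rfl⟩
    exact ⟨y, hy, _, ⟨⟨t, ht⟩, rfl⟩, rfl⟩

theorem le_coneOver (S : PointedCone ℝ E) (v : E) : S ≤ coneOver S v := le_sup_left

theorem self_mem_coneOver (S : PointedCone ℝ E) (v : E) : v ∈ coneOver S v :=
  mem_coneOver.2 ⟨0, S.zero_mem, 1, zero_le_one, by simp⟩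

theorem coneOver_le {S T : PointedCone ℝ E} {v : E} (hS : S ≤ T) (hv : v ∈ T) :
    coneOver S v ≤ T :=
  sup_le hS (Submodule.span_le.2 (by simpa using hv))

theorem coneOver_eq_self {S : PointedCone ℝ E} {v : E} (hv : v ∈ S) : coneOver S v = S :=
  le_antisymm (coneOver_le le_rfl hv) (le_coneOver S v)

@[simp] theorem cone_nil : cone ([] : List E) = ⊥ := by simp [cone]

theorem cone_cons (v : E) (l : List E) : cone (v :: l) = coneOver (cone l) v := by
  rw [cone, cone, coneOver, ← Submodule.span_union]
  congr 1
  ext w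
  simp

theorem mem_cone {l : List E} {v : E} (h : v ∈ l) : v ∈ cone l := Submodule.subset_span h

theorem cone_mono {l l' : List E} (h : ∀ v ∈ l, v ∈ l') : cone l ≤ cone l' :=
  Submodule.span_mono h

theorem mem_span_of_mem_cone {l : List E} {v : E} (h : v ∈ cone l) :
    v ∈ Submodule.span ℝ {w | w ∈ l} :=
  PointedCone.hull_le_span ℝ _ h

theorem span_cons (v : E) (l : List E) :
    Submodule.span ℝ {w | w ∈ v :: l} =
      Submodule.span ℝ {w | w ∈ l} ⊔ Submodule.span ℝ {v} := by
  rw [← Submodule.span_union]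
  congr 1
  ext w
  simp

/-- For a subcone, visibility from `v` is an algebraic condition: no translate of a point of the
subcone by `v` lies in the cone. -/
theorem isVisible_iff {C S : PointedCone ℝ E} {v : E} (hS : S ≤ C) :
    IsVisible C v S ↔ ∀ y ∈ S, v + y ∉ C := by
  constructor
  · rintro ⟨hv, h⟩ y hy hvy
    -- the midpoint of `v` and `y` is a second point of the segment in `C`
    have hm : ((1 / 2 : ℝ) • v + (1 / 2 : ℝ) • y) ∈ segment ℝ v y ∩ (C : Set E) :=
      ⟨⟨1 / 2, 1 / 2, by norm_num, by norm_num, by norm_num, rfl⟩, by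
        rw [← smul_add]
        exact C.smul_mem (by norm_num : (0 : ℝ) ≤ 1 / 2) hvy⟩
    rw [h y hy, Set.mem_singleton_iff] at hm
    have : v = y := by
      have h2 := congrArg (fun z => (2 : ℝ) • z) hm
      simp only [smul_add, smul_smul] at h2
      norm_num at h2
      rw [two_smul] at h2
      exact add_right_cancel h2
    exact hv (this ▸ hS hy)
  · intro h
    refine ⟨by simpa using h 0 S.zero_mem, fun y hy => ?_⟩
    ext z
    simp only [Set.mem_inter_iff, SetLike.mem_coe, Set.mem_singleton_iff]
    constructor
    · rintro ⟨⟨a, b, ha, hb, hab, rfl⟩, hz⟩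
      rcases ha.eq_or_lt with rfl | ha
      · have : b = 1 := by linarith
        simp [this]
      · refine absurd ?_ (h _ (S.smul_mem (div_nonneg hb ha.le) hy))
        have := C.smul_mem (inv_nonneg.2 ha.le) hz
        rwa [smul_add, smul_smul, smul_smul, inv_mul_cancel₀ ha.ne', one_smul, inv_mul_eq_div]
          at this
    · rintro rfl
      exact ⟨right_mem_segment ℝ v z, hS hy⟩

/-- The pyramid over a visible subcone meets the old cone only in its base. -/
theorem IsVisible.mem_of_mem_coneOver {C S : PointedCone ℝ E} {v x : E} (h : IsVisible C v S)
    (hS : S ≤ C) (hx : x ∈ coneOver S v) (hxC : x ∈ C) : x ∈ S := by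
  obtain ⟨y, hy, t, ht, rfl⟩ := mem_coneOver.1 hx
  rcases ht.eq_or_lt with rfl | ht
  · simpa using hy
  · refine absurd ?_ ((isVisible_iff hS).1 h _ (S.smul_mem (inv_nonneg.2 ht.le) hy))
    have := C.smul_mem (inv_nonneg.2 ht.le) hxC
    rwa [smul_add, smul_smul, inv_mul_cancel₀ ht.ne', one_smul, add_comm] at this

theorem IsVisible.mono {C C' S S' : PointedCone ℝ E} {v : E} (h : IsVisible C v S) (hS : S ≤ C)
    (hS' : S' ≤ S) (hC' : C' ≤ C) (hSC : S' ≤ C') : IsVisible C' v S' :=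
  (isVisible_iff hSC).2 fun y hy hvy => (isVisible_iff hS).1 h y (hS' hy) (hC' hvy)

theorem isVisible_of_notMem_span {l : List E} {S : PointedCone ℝ E} {v : E}
    (hv : v ∉ Submodule.span ℝ {w | w ∈ l}) (hS : S ≤ cone l) : IsVisible (cone l) v S := by
  refine (isVisible_iff hS).2 fun y hy hvy => hv ?_
  simpa using Submodule.sub_mem _ (mem_span_of_mem_cone hvy) (mem_span_of_mem_cone (hS hy))

theorem exists_add_eq_of_mem_span {S : PointedCone ℝ E} {x : E}
    (hx : x ∈ Submodule.span ℝ (S : Set E)) : ∃ a ∈ S, ∃ b ∈ S, x + b = a := by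
  induction hx using Submodule.span_induction with
  | mem x hx => exact ⟨x, hx, 0, S.zero_mem, by simp⟩
  | zero => exact ⟨0, S.zero_mem, 0, S.zero_mem, by simp⟩
  | add x y _ _ hx hy =>
    obtain ⟨a, ha, b, hb, h⟩ := hx
    obtain ⟨a', ha', b', hb', h'⟩ := hy
    exact ⟨a + a', S.add_mem ha ha', b + b', S.add_mem hb hb', by rw [← h, ← h']; abel⟩
  | smul t x _ hx =>
    obtain ⟨a, ha, b, hb, h⟩ := hx
    rcases le_total 0 t with ht | ht
    · exact ⟨t • a, S.smul_mem ht ha, t • b, S.smul_mem ht hb, by rw [← h, smul_add]⟩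
    · have ht' : 0 ≤ -t := by linarith
      refine ⟨(-t) • b, S.smul_mem ht' hb, (-t) • a, S.smul_mem ht' ha, ?_⟩
      rw [← h, smul_add, neg_smul, neg_smul]
      abel

/-- A point that sees a subcone lies outside of its span: a point `a - b` of the span with `a` and `b`
in the subcone would, added to `b`, end up in the cone. -/
theorem IsVisible.notMem_span {C S : PointedCone ℝ E} {v : E} (h : IsVisible C v S) (hS : S ≤ C) :
    v ∉ Submodule.span ℝ (S : Set E) := by
  intro hv
  obtain ⟨a, ha, b, hb, hab⟩ := exists_add_eq_of_mem_span hv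
  exact (isVisible_iff hS).1 h b hb (hab ▸ hS ha)

/-! ### Faces and subsystems -/

theorem isFaceOf_inf {F C C' : PointedCone ℝ E} (hF : F.IsFaceOf C) (h : C' ≤ C) :
    (F ⊓ C').IsFaceOf C' := by
  simpa [inf_eq_right.2 h] using hF.inf (PointedCone.IsFaceOf.refl C')

theorem mem_of_smul_mem {S : PointedCone ℝ E} {v : E} {t : ℝ} (ht : 0 < t) (h : t • v ∈ S) :
    v ∈ S := by
  simpa [smul_smul, inv_mul_cancel₀ ht.ne'] using S.smul_mem (inv_nonneg.2 ht.le) h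

@[simp] theorem subsystem_nil (P : PointedCone ℝ E) : subsystem [] P = [] := rfl

theorem subsystem_cons_of_mem {P : PointedCone ℝ E} {v : E} (l : List E) (hv : v ∈ P) :
    subsystem (v :: l) P = v :: subsystem l P := by
  simp [subsystem, hv]

theorem subsystem_cons_of_notMem {P : PointedCone ℝ E} {v : E} (l : List E) (hv : v ∉ P) :
    subsystem (v :: l) P = subsystem l P := by
  simp [subsystem, hv]

theorem mem_subsystem {P : PointedCone ℝ E} {l : List E} {v : E} :
    v ∈ subsystem l P ↔ v ∈ l ∧ v ∈ P := by
  simp [subsystem]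

theorem subsystem_reverse (l : List E) (P : PointedCone ℝ E) :
    (subsystem l P).reverse = subsystem l.reverse P := by
  simp [subsystem]

theorem subsystem_subsystem {l : List E} {P P' : PointedCone ℝ E} (h : P' ≤ P) :
    subsystem (subsystem l P) P' = subsystem l P' := by
  simp only [subsystem, List.filter_filter]
  refine List.filter_congr fun v _ => ?_
  by_cases hv : v ∈ P'
  · simp [hv, h hv]
  · simp [hv]

theorem subsystem_congr {l : List E} {P P' : PointedCone ℝ E}
    (h : ∀ v ∈ cone l, v ∈ P ↔ v ∈ P') : subsystem l P = subsystem l P' :=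
  List.filter_congr fun v hv => by simp [h v (mem_cone hv)]

theorem subsystem_inf_cone (l : List E) (P : PointedCone ℝ E) :
    subsystem l (P ⊓ cone l) = subsystem l P :=
  subsystem_congr fun v hv => by simp [hv]

theorem cone_subsystem_le (l : List E) (P : PointedCone ℝ E) : cone (subsystem l P) ≤ P :=
  Submodule.span_le.2 fun _ hv => (mem_subsystem.1 hv).2

theorem cone_le_cone_cons (v : E) (l : List E) : cone l ≤ cone (v :: l) :=
  cone_mono fun _ h => List.mem_cons_of_mem _ h

/-- A face of a cone is generated by the vectors of the system that it contains. -/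
theorem cone_subsystem_of_isFaceOf {l : List E} {F : PointedCone ℝ E}
    (hF : F.IsFaceOf (cone l)) : cone (subsystem l F) = F := by
  induction l generalizing F with
  | nil =>
    obtain rfl : F = ⊥ := by simpa using hF.le
    simp
  | cons v l ih =>
    refine le_antisymm (cone_subsystem_le _ _) fun x hx => ?_
    have hC := cone_le_cone_cons v l
    have hF0 := ih (isFaceOf_inf hF hC)
    rw [subsystem_inf_cone] at hF0
    have hxC := hF.le hx
    rw [cone_cons] at hxC
    obtain ⟨y, hy, t, ht, rfl⟩ := mem_coneOver.1 hxC
    have hvC : v ∈ cone (v :: l) := mem_cone (by simp)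
    obtain ⟨hyF, hvF⟩ := (hF.add_mem_iff_mem (hC hy) (PointedCone.smul_mem _ ht hvC)).1 hx
    have hy' : y ∈ cone (subsystem l F) := by rw [hF0]; exact ⟨hyF, hy⟩
    rcases ht.eq_or_lt with rfl | ht
    · rw [zero_smul, add_zero]
      refine cone_mono (fun w hw => ?_) hy'
      rw [mem_subsystem] at hw ⊢
      exact ⟨List.mem_cons_of_mem _ hw.1, hw.2⟩
    · rw [subsystem_cons_of_mem l (mem_of_smul_mem ht hvF), cone_cons]
      exact mem_coneOver.2 ⟨y, hy', t, ht.le, rfl⟩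

theorem subsystem_coneOver {l : List E} {F : PointedCone ℝ E} {v : E} (hF : F ≤ cone l)
    (h : IsVisible (cone l) v F) : subsystem (v :: l) (coneOver F v) = v :: subsystem l F := by
  rw [subsystem_cons_of_mem l (self_mem_coneOver F v)]
  congr 1
  exact subsystem_congr fun w hw => ⟨fun hw' => h.mem_of_mem_coneOver hF hw' hw,
    fun hw' => le_coneOver F v hw'⟩

/-- The smallest face of `C` that contains the subcone `σ`. -/
def faceHull (C σ : PointedCone ℝ E) : PointedCone ℝ E where
  carrier := {a | a ∈ C ∧ ∃ b ∈ C, a + b ∈ σ}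
  add_mem' := by
    rintro a a' ⟨ha, b, hb, hab⟩ ⟨ha', b', hb', hab'⟩
    refine ⟨C.add_mem ha ha', b + b', C.add_mem hb hb', ?_⟩
    rw [add_add_add_comm]
    exact σ.add_mem hab hab'
  zero_mem' := ⟨C.zero_mem, 0, C.zero_mem, by simp⟩
  smul_mem' := by
    rintro t a ⟨ha, b, hb, hab⟩
    refine ⟨C.smul_mem t.2 ha, t • b, C.smul_mem t.2 hb, ?_⟩
    rw [← smul_add]
    exact σ.smul_mem t.2 hab

theorem le_faceHull {C σ : PointedCone ℝ E} (h : σ ≤ C) : σ ≤ faceHull C σ :=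
  fun a ha => ⟨h ha, 0, C.zero_mem, by simpa using ha⟩

theorem isFaceOf_faceHull (C σ : PointedCone ℝ E) : (faceHull C σ).IsFaceOf C where
  le _ h := h.1
  mem_of_smul_add_mem := by
    rintro x y a hx hy ha ⟨-, b, hb, h⟩
    refine ⟨hx, a⁻¹ • (y + b), C.smul_mem (inv_nonneg.2 ha.le) (C.add_mem hy hb), ?_⟩
    have := σ.smul_mem (inv_nonneg.2 ha.le) h
    rwa [add_assoc, smul_add, smul_smul, inv_mul_cancel₀ ha.ne', one_smul] at this

/-- Visibility of a subcone extends to the smallest face that contains it. Thus a cone of the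
lexicographic triangulation is visible if and only if it lies in a visible face. -/
theorem IsVisible.faceHull {C σ : PointedCone ℝ E} {v : E} (h : IsVisible C v σ) (hσ : σ ≤ C) :
    IsVisible C v (faceHull C σ) := by
  refine (isVisible_iff (isFaceOf_faceHull C σ).le).2 ?_
  rintro a ⟨-, b, hb, hab⟩ hva
  refine (isVisible_iff hσ).1 h _ hab ?_
  rw [← add_assoc]
  exact C.add_mem hva hb

/-! ### The lexicographic triangulation and the faces of the cone -/

theorem le_cone_of_mem_lexTriangulationRev {l : List E} {σ : PointedCone ℝ E}
    (h : σ ∈ lexTriangulationRev l) : σ ≤ cone l := by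
  induction l generalizing σ with
  | nil => simpa [lexTriangulationRev] using h
  | cons v l ih =>
    rcases h with h | ⟨τ, hτ, -, rfl⟩
    · exact (ih h).trans (cone_le_cone_cons v l)
    · exact coneOver_le ((ih hτ).trans (cone_le_cone_cons v l)) (mem_cone (by simp))

theorem lexTriangulationRev_cons_of_mem {l : List E} {v : E} (hv : v ∈ cone l) :
    lexTriangulationRev (v :: l) = lexTriangulationRev l := by
  refine Set.union_eq_self_of_subset_right ?_
  rintro _ ⟨σ, -, h, -⟩
  exact absurd hv h.1

/-- The lexicographic triangulation restricts to the faces of the cone. -/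
theorem mem_lexTriangulationRev_subsystem_iff {l : List E} {F σ : PointedCone ℝ E}
    (hF : F.IsFaceOf (cone l)) :
    σ ∈ lexTriangulationRev (subsystem l F) ↔ σ ∈ lexTriangulationRev l ∧ σ ≤ F := by
  induction l generalizing F σ with
  | nil =>
    simp only [subsystem_nil, lexTriangulationRev, Set.mem_singleton_iff, iff_self_and]
    rintro rfl
    exact bot_le
  | cons v l ih =>
    have hC := cone_le_cone_cons v l
    have hF0 := isFaceOf_inf hF hC
    have key : ∀ τ, τ ∈ lexTriangulationRev (subsystem l F) ↔
        τ ∈ lexTriangulationRev l ∧ τ ≤ F := by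
      intro τ
      rw [← subsystem_inf_cone, ih hF0, and_congr_right_iff]
      intro hτ
      exact ⟨fun h => h.trans inf_le_left,
        fun h => le_inf h (le_cone_of_mem_lexTriangulationRev hτ)⟩
    have hcone : cone (subsystem l F) = F ⊓ cone l := by
      rw [← subsystem_inf_cone, cone_subsystem_of_isFaceOf hF0]
    by_cases hv : v ∈ F
    · have hvis : ∀ τ : PointedCone ℝ E, τ ≤ F → τ ≤ cone l →
          (IsVisible (cone (subsystem l F)) v τ ↔ IsVisible (cone l) v τ) := by
        intro τ h1 h2
        rw [hcone, isVisible_iff (le_inf h1 h2), isVisible_iff h2]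
        refine forall₂_congr fun y hy => not_congr ?_
        simp [F.add_mem hv (h1 hy)]
      rw [subsystem_cons_of_mem l hv]
      constructor
      · rintro (h | ⟨τ, hτ, h, rfl⟩)
        · exact ⟨Or.inl ((key σ).1 h).1, ((key σ).1 h).2⟩
        · obtain ⟨h1, h2⟩ := (key τ).1 hτ
          have := (hvis τ h2 (le_cone_of_mem_lexTriangulationRev h1)).1 h
          exact ⟨Or.inr ⟨τ, h1, this, rfl⟩, coneOver_le h2 hv⟩
      · rintro ⟨h | ⟨τ, hτ, h, rfl⟩, hσ⟩
        · exact Or.inl ((key σ).2 ⟨h, hσ⟩)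
        · have h2 := (le_coneOver τ v).trans hσ
          exact Or.inr ⟨τ, (key τ).2 ⟨hτ, h2⟩,
            (hvis τ h2 (le_cone_of_mem_lexTriangulationRev hτ)).2 h, rfl⟩
    · rw [subsystem_cons_of_notMem l hv, key]
      constructor
      · exact fun h => ⟨Or.inl h.1, h.2⟩
      · rintro ⟨h | ⟨τ, hτ, h, rfl⟩, hσ⟩
        · exact ⟨h, hσ⟩
        · exact absurd (hσ (self_mem_coneOver τ v)) hv

/-! ### Pyramid decomposition without rearrangement -/

/-- The pyramid decomposition of a system listed with its last vector first, by a recursion that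
does not rearrange the system. A vector outside the span of the preceding ones is put on top of all
pyramids found so far; any other vector is put on top of the visible faces of the cone. -/
def pyramidRec : List E → Set (PointedCone ℝ E)
  | [] => {⊥}
  | v :: l => pyramidRec l ∪ {P | ∃ F : PointedCone ℝ E,
      ((v ∉ Submodule.span ℝ {w | w ∈ l} ∧ F ∈ pyramidRec l) ∨
        (v ∈ Submodule.span ℝ {w | w ∈ l} ∧ F.IsFaceOf (cone l) ∧ IsVisible (cone l) v F)) ∧
      P = coneOver F v}

/-- Every pyramid is generated by the vectors of the system that it contains. -/
theorem le_cone_and_cone_subsystem_of_mem_pyramidRec {l : List E} {P : PointedCone ℝ E}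
    (h : P ∈ pyramidRec l) : P ≤ cone l ∧ cone (subsystem l P) = P := by
  induction l generalizing P with
  | nil =>
    obtain rfl : P = ⊥ := h
    simp
  | cons v l ih =>
    rcases h with h | ⟨F, hF, rfl⟩
    · obtain ⟨h1, h2⟩ := ih h
      refine ⟨h1.trans (cone_le_cone_cons v l), ?_⟩
      by_cases hv : v ∈ P
      · rw [subsystem_cons_of_mem l hv, cone_cons, h2, coneOver_eq_self hv]
      · rw [subsystem_cons_of_notMem l hv, h2]
    · have key : F ≤ cone l ∧ cone (subsystem l F) = F ∧ IsVisible (cone l) v F := by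
        rcases hF with ⟨hv, hF⟩ | ⟨hv, hF, hvis⟩
        · exact ⟨(ih hF).1, (ih hF).2, isVisible_of_notMem_span hv (ih hF).1⟩
        · exact ⟨hF.le, cone_subsystem_of_isFaceOf hF, hvis⟩
      obtain ⟨h1, h2, h3⟩ := key
      refine ⟨coneOver_le (h1.trans (cone_le_cone_cons v l)) (mem_cone (by simp)), ?_⟩
      rw [subsystem_coneOver h1 h3, cone_cons, h2]

theorem le_cone_of_mem_pyramidRec {l : List E} {P : PointedCone ℝ E} (h : P ∈ pyramidRec l) :
    P ≤ cone l :=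
  (le_cone_and_cone_subsystem_of_mem_pyramidRec h).1

theorem cone_subsystem_of_mem_pyramidRec {l : List E} {P : PointedCone ℝ E}
    (h : P ∈ pyramidRec l) : cone (subsystem l P) = P :=
  (le_cone_and_cone_subsystem_of_mem_pyramidRec h).2

/-- The lexicographic triangulation is the union of the lexicographic triangulations of the
pyramids. -/
theorem mem_lexTriangulationRev_iff_exists_pyramidRec {l : List E} {σ : PointedCone ℝ E} :
    σ ∈ lexTriangulationRev l ↔
      ∃ P ∈ pyramidRec l, σ ∈ lexTriangulationRev (subsystem l P) := by
  induction l generalizing σ with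
  | nil => simp [pyramidRec]
  | cons v l ih =>
    constructor
    · rintro (h | ⟨τ, hτ, hvis, rfl⟩)
      · obtain ⟨P, hP, h⟩ := ih.1 h
        refine ⟨P, Or.inl hP, ?_⟩
        by_cases hv : v ∈ P
        · rw [subsystem_cons_of_mem l hv]
          exact Or.inl h
        · rwa [subsystem_cons_of_notMem l hv]
      · have hτl := le_cone_of_mem_lexTriangulationRev hτ
        have lift : ∀ F : PointedCone ℝ E, F ≤ cone l → cone (subsystem l F) = F →
            IsVisible (cone l) v F → τ ∈ lexTriangulationRev (subsystem l F) →
            coneOver τ v ∈ lexTriangulationRev (subsystem (v :: l) (coneOver F v)) := by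
          intro F h1 h2 h3 h4
          rw [subsystem_coneOver h1 h3]
          exact Or.inr ⟨τ, h4, hvis.mono hτl le_rfl (h2.le.trans h1)
            (le_cone_of_mem_lexTriangulationRev h4), rfl⟩
        by_cases hv : v ∈ Submodule.span ℝ {w | w ∈ l}
        · have hF := isFaceOf_faceHull (cone l) τ
          have hFv := hvis.faceHull hτl
          exact ⟨_, Or.inr ⟨_, Or.inr ⟨hv, hF, hFv⟩, rfl⟩,
            lift _ hF.le (cone_subsystem_of_isFaceOf hF) hFv
              ((mem_lexTriangulationRev_subsystem_iff hF).2 ⟨hτ, le_faceHull hτl⟩)⟩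
        · obtain ⟨P, hP, h⟩ := ih.1 hτ
          have hPl := le_cone_of_mem_pyramidRec hP
          exact ⟨_, Or.inr ⟨P, Or.inl ⟨hv, hP⟩, rfl⟩,
            lift P hPl (cone_subsystem_of_mem_pyramidRec hP) (isVisible_of_notMem_span hv hPl) h⟩
    · rintro ⟨_, hP | ⟨F, hF, rfl⟩, h⟩
      · rename_i P
        refine Or.inl (ih.2 ⟨P, hP, ?_⟩)
        by_cases hv : v ∈ P
        · rwa [subsystem_cons_of_mem l hv, lexTriangulationRev_cons_of_mem] at h
          rwa [cone_subsystem_of_mem_pyramidRec hP]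
        · rwa [subsystem_cons_of_notMem l hv] at h
      · have key : F ≤ cone l ∧ cone (subsystem l F) = F ∧ IsVisible (cone l) v F ∧
            ∀ τ ∈ lexTriangulationRev (subsystem l F), τ ∈ lexTriangulationRev l := by
          rcases hF with ⟨hv, hF⟩ | ⟨-, hF, hvis⟩
          · have hFl := le_cone_of_mem_pyramidRec hF
            exact ⟨hFl, cone_subsystem_of_mem_pyramidRec hF, isVisible_of_notMem_span hv hFl,
              fun τ hτ => ih.2 ⟨F, hF, hτ⟩⟩
          · exact ⟨hF.le, cone_subsystem_of_isFaceOf hF, hvis,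
              fun τ hτ => ((mem_lexTriangulationRev_subsystem_iff hF).1 hτ).1⟩
        obtain ⟨h1, h2, h3, h4⟩ := key
        rw [subsystem_coneOver h1 h3] at h
        rcases h with h | ⟨τ, hτ, -, rfl⟩
        · exact Or.inl (h4 _ h)
        · have hτF : τ ≤ F := (le_cone_of_mem_lexTriangulationRev hτ).trans h2.le
          exact Or.inr ⟨τ, h4 τ hτ, h3.mono h1 hτF le_rfl (hτF.trans h1), rfl⟩

/-! ### The excess of a system -/

open Classical in
/-- The number of vectors of a system (listed with its last vector first) that lie in the span of
the preceding vectors but not in their cone: exactly at these vectors `pyramidRec` has to choose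
visible faces. -/
def excess : List E → ℕ
  | [] => 0
  | v :: l => excess l + if v ∈ Submodule.span ℝ {w | w ∈ l} ∧ v ∉ cone l then 1 else 0

theorem excess_cons_of_notMem_span {l : List E} {v : E}
    (hv : v ∉ Submodule.span ℝ {w | w ∈ l}) : excess (v :: l) = excess l := by
  simp [excess, hv]

theorem excess_cons_of_mem_cone {l : List E} {v : E} (hv : v ∈ cone l) :
    excess (v :: l) = excess l := by
  simp [excess, hv]

theorem excess_cons {l : List E} {v : E} (hv : v ∈ Submodule.span ℝ {w | w ∈ l})
    (hv' : v ∉ cone l) : excess (v :: l) = excess l + 1 := by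
  simp [excess, hv, hv']

theorem excess_le_excess_cons (v : E) (l : List E) : excess l ≤ excess (v :: l) :=
  Nat.le_add_right _ _

/-- A vector of a face that lies in the cone of the preceding vectors lies in the cone of those among
them that belong to the face, so that the face has no new vectors that count. -/
theorem excess_subsystem_le_of_isFaceOf {l : List E} {F : PointedCone ℝ E}
    (hF : F.IsFaceOf (cone l)) : excess (subsystem l F) ≤ excess l := by
  induction l generalizing F with
  | nil => simp
  | cons v l ih =>
    have hF0 := isFaceOf_inf hF (cone_le_cone_cons v l)
    have hle := ih hF0
    rw [subsystem_inf_cone] at hle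
    by_cases hvF : v ∈ F
    · rw [subsystem_cons_of_mem l hvF]
      by_cases hv : v ∈ Submodule.span ℝ {w | w ∈ l}
      · by_cases hv' : v ∈ cone l
        · rw [excess_cons_of_mem_cone hv', excess_cons_of_mem_cone]
          · exact hle
          · rw [← subsystem_inf_cone, cone_subsystem_of_isFaceOf hF0]
            exact ⟨hvF, hv'⟩
        · rw [excess_cons hv hv', excess]
          split <;> omega
      · rw [excess_cons_of_notMem_span hv, excess_cons_of_notMem_span]
        · exact hle
        · exact fun h => hv (Submodule.span_mono (fun w hw => (mem_subsystem.1 hw).1) h)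
    · rw [subsystem_cons_of_notMem l hvF]
      exact hle.trans (excess_le_excess_cons v l)

/-- The passage to a pyramid lowers a positive excess. -/
theorem excess_subsystem_of_mem_pyramidRec {l : List E} {P : PointedCone ℝ E}
    (h : P ∈ pyramidRec l) : excess (subsystem l P) ≤ excess l - 1 := by
  induction l generalizing P with
  | nil => simp [excess]
  | cons v l ih =>
    have hle := excess_le_excess_cons v l
    rcases h with h | ⟨F, ⟨hv, hF⟩ | ⟨hv, hF, hvis⟩, rfl⟩
    · have := ih h
      by_cases hv : v ∈ P
      · rw [subsystem_cons_of_mem l hv, excess_cons_of_mem_cone]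
        · omega
        · rwa [cone_subsystem_of_mem_pyramidRec h]
      · rw [subsystem_cons_of_notMem l hv]
        omega
    · have hFl := le_cone_of_mem_pyramidRec hF
      rw [subsystem_coneOver hFl (isVisible_of_notMem_span hv hFl),
        excess_cons_of_notMem_span hv, excess_cons_of_notMem_span]
      · exact ih hF
      · exact fun h => hv (Submodule.span_mono (fun w hw => (mem_subsystem.1 hw).1) h)
    · -- `v` counts for the system, but not for the pyramid, since it is not in the span of `F`
      rw [subsystem_coneOver hF.le hvis, excess_cons hv hvis.1, excess_cons_of_notMem_span]
      · simpa using excess_subsystem_le_of_isFaceOf hF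
      · exact fun h => hvis.notMem_span hF.le
          (Submodule.span_mono (fun w hw => (mem_subsystem.1 hw).2) h)

/-- If no vector counts for the excess, then both recursions only put new apexes outside of the span
on top of all cones found so far. -/
theorem pyramidRec_eq_lexTriangulationRev {l : List E} (h : excess l = 0) :
    pyramidRec l = lexTriangulationRev l := by
  induction l with
  | nil => rfl
  | cons v l ih =>
    have hl := ih (Nat.le_zero.1 (h ▸ excess_le_excess_cons v l))
    by_cases hv : v ∈ Submodule.span ℝ {w | w ∈ l}
    · have hv' : v ∈ cone l := by
        by_contra hv'
        rw [excess_cons hv hv'] at h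
        omega
      rw [lexTriangulationRev_cons_of_mem hv', ← hl]
      refine Set.union_eq_self_of_subset_right ?_
      rintro _ ⟨F, ⟨hn, -⟩ | ⟨-, -, hvis⟩, -⟩
      · exact absurd hv hn
      · exact absurd hv' hvis.1
    · rw [pyramidRec, lexTriangulationRev, hl]
      congr 1
      ext P
      constructor
      · rintro ⟨F, ⟨-, hF⟩ | ⟨hs, -⟩, rfl⟩
        · exact ⟨F, hF,
            isVisible_of_notMem_span hv (le_cone_of_mem_lexTriangulationRev hF), rfl⟩
        · exact absurd hs hv
      · rintro ⟨σ, hσ, -, rfl⟩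
        exact ⟨σ, Or.inl ⟨hv, hσ⟩, rfl⟩

theorem excess_add_finrank_le (l : List E) :
    excess l + Module.finrank ℝ (Submodule.span ℝ {w | w ∈ l}) ≤ l.length := by
  induction l with
  | nil =>
    have : {w : E | w ∈ ([] : List E)} = ∅ := by ext; simp
    rw [this, Submodule.span_empty, finrank_bot]
    simp [excess]
  | cons v l ih =>
    by_cases hv : v ∈ Submodule.span ℝ {w | w ∈ l}
    · have : excess (v :: l) ≤ excess l + 1 := by
        rw [excess]
        split <;> omega
      rw [span_cons, sup_eq_left.2 (Submodule.span_le.2 (by simpa using hv)), List.length_cons]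
      omega
    · have : FiniteDimensional ℝ (Submodule.span ℝ {w | w ∈ l}) :=
        FiniteDimensional.span_of_finite ℝ (List.finite_toSet l)
      have h1 := Submodule.finrank_add_le_finrank_add_finrank
        (Submodule.span ℝ {w | w ∈ l}) (Submodule.span ℝ {v})
      have hv0 : v ≠ 0 := by
        rintro rfl
        exact hv (Submodule.zero_mem _)
      have h2 := finrank_span_singleton (K := ℝ) hv0
      rw [excess_cons_of_notMem_span hv, span_cons, List.length_cons]
      omega

/-! ### Rearrangement -/

theorem eq_of_add_smul_eq_add_smul {l : List E} {v a b : E} {s t : ℝ}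
    (hv : v ∉ Submodule.span ℝ {w | w ∈ l}) (ha : a ∈ Submodule.span ℝ {w | w ∈ l})
    (hb : b ∈ Submodule.span ℝ {w | w ∈ l}) (h : a + s • v = b + t • v) : s = t ∧ a = b := by
  have hst : s = t := by
    by_contra hne
    have h1 : (s - t) • v = b - a := by
      rw [sub_smul, sub_eq_sub_iff_add_eq_add, add_comm, h]
    refine hv ((Submodule.smul_mem_iff _ (sub_ne_zero.2 hne)).1 ?_)
    rw [h1]
    exact Submodule.sub_mem _ hb ha
  subst hst
  exact ⟨rfl, add_right_cancel h⟩

/-- The faces of a cone with a new apex outside of its span are the faces of the old cone and the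
cones over them. -/
theorem isFaceOf_coneOver_iff {l : List E} {v : E} {P : PointedCone ℝ E}
    (hv : v ∉ Submodule.span ℝ {w | w ∈ l}) :
    P.IsFaceOf (coneOver (cone l) v) ↔
      P.IsFaceOf (cone l) ∨ ∃ F : PointedCone ℝ E, F.IsFaceOf (cone l) ∧ P = coneOver F v := by
  constructor
  · intro hP
    have hF := isFaceOf_inf hP (le_coneOver (cone l) v)
    have hvC := self_mem_coneOver (cone l) v
    by_cases hvP : v ∈ P
    · refine Or.inr ⟨_, hF, le_antisymm (fun x hx => ?_) (coneOver_le inf_le_left hvP)⟩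
      obtain ⟨y, hy, t, ht, rfl⟩ := mem_coneOver.1 (hP.le hx)
      have := hP.mem_of_add_mem_left (le_coneOver _ v hy) (PointedCone.smul_mem _ ht hvC) hx
      exact mem_coneOver.2 ⟨y, ⟨this, hy⟩, t, ht, rfl⟩
    · have : P ≤ cone l := by
        intro x hx
        obtain ⟨y, hy, t, ht, rfl⟩ := mem_coneOver.1 (hP.le hx)
        have := hP.mem_of_add_mem_right (le_coneOver _ v hy) (PointedCone.smul_mem _ ht hvC) hx
        rcases ht.eq_or_lt with rfl | ht
        · simpa using hy
        · exact absurd (mem_of_smul_mem ht this) hvP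
      rw [inf_eq_left.2 this] at hF
      exact Or.inl hF
  · rintro (hP | ⟨F, hF, rfl⟩)
    · refine ⟨hP.le.trans (le_coneOver _ v), ?_⟩
      intro x y a hx hy ha h
      obtain ⟨x, hxl, s, hs, rfl⟩ := mem_coneOver.1 hx
      obtain ⟨y, hyl, t, ht, rfl⟩ := mem_coneOver.1 hy
      have e : a • (x + s • v) + (y + t • v) = (a • x + y) + (a * s + t) • v := by
        rw [smul_add, add_smul, smul_smul]; abel
      have hxy : a • x + y ∈ cone l := add_mem (PointedCone.smul_mem _ ha.le hxl) hyl
      rw [e] at h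
      have h0 := (eq_of_add_smul_eq_add_smul (s := a * s + t) (t := 0) hv
        (mem_span_of_mem_cone hxy) (mem_span_of_mem_cone (hP.le h)) (by rw [zero_smul, add_zero])).1
      have hs0 : s = 0 := by
        have := mul_nonneg ha.le hs
        have : a * s = 0 := by linarith
        exact (mul_eq_zero.1 this).resolve_left ha.ne'
      rw [h0, zero_smul, add_zero] at h
      rw [hs0, zero_smul, add_zero]
      exact hP.mem_of_smul_add_mem hxl hyl ha h
    · refine ⟨coneOver_le (hF.le.trans (le_coneOver _ v)) (self_mem_coneOver _ v), ?_⟩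
      intro x y a hx hy ha h
      obtain ⟨x, hxl, s, hs, rfl⟩ := mem_coneOver.1 hx
      obtain ⟨y, hyl, t, ht, rfl⟩ := mem_coneOver.1 hy
      obtain ⟨z, hz, r, hr, h⟩ := mem_coneOver.1 h
      have e : a • (x + s • v) + (y + t • v) = (a • x + y) + (a * s + t) • v := by
        rw [smul_add, add_smul, smul_smul]; abel
      have hxy : a • x + y ∈ cone l := add_mem (PointedCone.smul_mem _ ha.le hxl) hyl
      have h0 := (eq_of_add_smul_eq_add_smul hv (mem_span_of_mem_cone (hF.le hz))
        (mem_span_of_mem_cone hxy) (h.trans e)).2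
      exact mem_coneOver.2 ⟨x, hF.mem_of_smul_add_mem hxl hyl ha (h0 ▸ hz), s, hs, rfl⟩

theorem isVisible_coneOver_iff {l : List E} {v w : E} {S : PointedCone ℝ E}
    (hv : v ∉ Submodule.span ℝ {u | u ∈ l}) (hw : w ∈ Submodule.span ℝ {u | u ∈ l})
    (hS : S ≤ cone l) :
    IsVisible (coneOver (cone l) v) w S ↔ IsVisible (cone l) w S := by
  have hC := le_coneOver (cone l) v
  rw [isVisible_iff (hS.trans hC), isVisible_iff hS]
  refine forall₂_congr fun y hy => not_congr ⟨fun h => ?_, fun h => hC h⟩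
  obtain ⟨c, hc, s, -, h⟩ := mem_coneOver.1 h
  have := (eq_of_add_smul_eq_add_smul (t := 0) hv (mem_span_of_mem_cone hc)
    (Submodule.add_mem _ hw (mem_span_of_mem_cone (hS hy)))
    (by rw [h, zero_smul, add_zero])).2
  exact this ▸ hc

theorem isVisible_coneOver_coneOver_iff {l : List E} {v w : E} {S : PointedCone ℝ E}
    (hv : v ∉ Submodule.span ℝ {u | u ∈ l}) (hw : w ∈ Submodule.span ℝ {u | u ∈ l})
    (hS : S ≤ cone l) :
    IsVisible (coneOver (cone l) v) w (coneOver S v) ↔ IsVisible (cone l) w S := by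
  have hSC : coneOver S v ≤ coneOver (cone l) v := sup_le_sup_right hS _
  constructor
  · exact fun h => h.mono hSC (le_coneOver S v) (le_coneOver _ v) hS
  · intro h
    rw [isVisible_iff hSC]
    intro y hy hwy
    obtain ⟨y, hyS, t, -, rfl⟩ := mem_coneOver.1 hy
    obtain ⟨c, hc, s, -, hcs⟩ := mem_coneOver.1 hwy
    have := (eq_of_add_smul_eq_add_smul hv (mem_span_of_mem_cone hc)
      (Submodule.add_mem _ hw (mem_span_of_mem_cone (hS hyS)))
      (hcs.trans (add_assoc w y (t • v)).symm)).2
    exact (isVisible_iff hS).1 h y hyS (this ▸ hc)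

theorem coneOver_right_comm (S : PointedCone ℝ E) (v w : E) :
    coneOver (coneOver S v) w = coneOver (coneOver S w) v :=
  sup_right_comm _ _ _

theorem cone_congr {l l' : List E} (h : ∀ v, v ∈ l ↔ v ∈ l') : cone l = cone l' :=
  le_antisymm (cone_mono fun v => (h v).1) (cone_mono fun v => (h v).2)

/-- A new vector `v` outside the span can be moved back past the vectors `r` in the span of the
initial system `b`, provided that the decomposition of `b` consists of the faces of its cone. -/
theorem pyramidDecRev_append_cons {b r : List E} {v : E}
    (hv : v ∉ Submodule.span ℝ {w | w ∈ b}) (hr : ∀ w ∈ r, w ∈ Submodule.span ℝ {w | w ∈ b})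
    (hb : ∀ P, P ∈ pyramidDecRev b ↔ P.IsFaceOf (cone b)) :
    pyramidDecRev (r ++ v :: b) =
      pyramidDecRev (r ++ b) ∪ {P | ∃ F ∈ pyramidDecRev (r ++ b), P = coneOver F v} := by
  induction r with
  | nil =>
    simp only [List.nil_append]
    rw [pyramidDecRev]
    congr 1
    ext P
    refine exists_congr fun F => ?_
    rw [hb F, ← and_assoc, and_congr_left_iff]
    rintro -
    exact and_iff_left_of_imp fun hF => isVisible_of_notMem_span hv hF.le
  | cons w r ih =>
    have hs : Submodule.span ℝ {w | w ∈ r ++ b} ≤ Submodule.span ℝ {w | w ∈ b} := by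
      refine Submodule.span_le.2 fun u hu => ?_
      rcases List.mem_append.1 hu with hu | hu
      · exact hr u (by simp [hu])
      · exact Submodule.subset_span hu
    have hv' : v ∉ Submodule.span ℝ {w | w ∈ r ++ b} := fun h => hv (hs h)
    have hw : w ∈ Submodule.span ℝ {w | w ∈ r ++ b} :=
      Submodule.span_mono (fun u hu => List.mem_append_right _ hu) (hr w (by simp))
    have hcone : cone (r ++ v :: b) = coneOver (cone (r ++ b)) v := by
      rw [← cone_cons]
      exact cone_congr fun u => by simp [or_left_comm]
    rw [List.cons_append, List.cons_append, pyramidDecRev, pyramidDecRev, hcone,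
      ih fun u hu => hr u (by simp [hu])]
    ext P
    constructor
    · rintro ((h | ⟨F, hF, rfl⟩) | ⟨G, hG, hvis, rfl⟩)
      · exact Or.inl (Or.inl h)
      · exact Or.inr ⟨F, Or.inl hF, rfl⟩
      · rcases (isFaceOf_coneOver_iff hv').1 hG with hG | ⟨F, hF, rfl⟩
        · exact Or.inl (Or.inr ⟨G, hG, (isVisible_coneOver_iff hv' hw hG.le).1 hvis, rfl⟩)
        · exact Or.inr ⟨_, Or.inr ⟨F, hF,
            (isVisible_coneOver_coneOver_iff hv' hw hF.le).1 hvis, rfl⟩,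
            coneOver_right_comm F v w⟩
    · rintro ((h | ⟨F, hF, hvis, rfl⟩) | ⟨_, h | ⟨F, hF, hvis, rfl⟩, rfl⟩)
      · exact Or.inl (Or.inl h)
      · exact Or.inr ⟨F, (isFaceOf_coneOver_iff hv').2 (Or.inl hF),
          (isVisible_coneOver_iff hv' hw hF.le).2 hvis, rfl⟩
      · exact Or.inl (Or.inr ⟨_, h, rfl⟩)
      · exact Or.inr ⟨_, (isFaceOf_coneOver_iff hv').2 (Or.inr ⟨F, hF, rfl⟩),
          (isVisible_coneOver_coneOver_iff hv' hw hF.le).2 hvis, coneOver_right_comm F w v⟩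

theorem sup_span_cons (V : Submodule ℝ E) (u : E) (l : List E) :
    V ⊔ Submodule.span ℝ {w | w ∈ u :: l} =
      V ⊔ Submodule.span ℝ {u} ⊔ Submodule.span ℝ {w | w ∈ l} := by
  rw [span_cons, sup_comm (Submodule.span ℝ {w | w ∈ l}), sup_assoc]

open Classical in
theorem basisPart_concat (V : Submodule ℝ E) (l : List E) (v : E) :
    basisPart V (l ++ [v]) =
      basisPart V l ++ if v ∈ V ⊔ Submodule.span ℝ {w | w ∈ l} then [] else [v] := by
  induction l generalizing V with
  | nil => simp [basisPart]
  | cons u l ih =>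
    rw [sup_span_cons, List.cons_append, basisPart, basisPart]
    split_ifs with hu h h
    · rw [ih, if_pos (by
        rwa [sup_eq_left.2 ((Submodule.span_singleton_le_iff_mem u V).2 hu)] at h)]
    · rw [ih, if_neg (by
        rwa [sup_eq_left.2 ((Submodule.span_singleton_le_iff_mem u V).2 hu)] at h)]
    · rw [ih, if_pos h, List.cons_append]
    · rw [ih, if_neg h, List.cons_append]

open Classical in
theorem redundantPart_concat (V : Submodule ℝ E) (l : List E) (v : E) :
    redundantPart V (l ++ [v]) =
      redundantPart V l ++ if v ∈ V ⊔ Submodule.span ℝ {w | w ∈ l} then [v] else [] := by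
  induction l generalizing V with
  | nil => simp [redundantPart]
  | cons u l ih =>
    rw [sup_span_cons, List.cons_append, redundantPart, redundantPart]
    split_ifs with hu h h
    · rw [ih, if_pos (by
        rwa [sup_eq_left.2 ((Submodule.span_singleton_le_iff_mem u V).2 hu)] at h),
        List.cons_append]
    · rw [ih, if_neg (by
        rwa [sup_eq_left.2 ((Submodule.span_singleton_le_iff_mem u V).2 hu)] at h),
        List.cons_append]
    · rw [ih, if_pos h]
    · rw [ih, if_neg h]

theorem mem_arrange {l : List E} {v : E} : v ∈ arrange l ↔ v ∈ l := by
  have : ∀ V : Submodule ℝ E, v ∈ basisPart V l ∨ v ∈ redundantPart V l ↔ v ∈ l := by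
    induction l with
    | nil => simp [basisPart, redundantPart]
    | cons u l ih =>
      intro V
      rw [basisPart, redundantPart]
      split_ifs with hu
      · rw [List.mem_cons, List.mem_cons, ← ih V, or_left_comm]
      · rw [List.mem_cons, List.mem_cons, ← ih (V ⊔ Submodule.span ℝ {u}), or_assoc]
  rw [arrange, List.mem_append, this]

/-- Rearranging a system and the recursion `pyramidRec` lead to the same pyramids. The induction
carries along that the basis part spans and that its decomposition consists of the faces of its
(simplicial) cone. -/
theorem pyramidDec_eq_pyramidRec (l : List E) : pyramidDec l = pyramidRec l.reverse := by
  have key : (∀ w ∈ l, w ∈ Submodule.span ℝ {w | w ∈ (basisPart ⊥ l).reverse}) ∧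
      (∀ P, P ∈ pyramidDecRev (basisPart ⊥ l).reverse ↔
        P.IsFaceOf (cone (basisPart ⊥ l).reverse)) ∧
      pyramidDecRev ((redundantPart ⊥ l).reverse ++ (basisPart ⊥ l).reverse) =
        pyramidRec l.reverse := by
    induction l using List.reverseRecOn with
    | nil =>
      refine ⟨by simp, fun P => ?_, rfl⟩
      simp only [basisPart, List.reverse_nil, pyramidDecRev, cone_nil, Set.mem_singleton_iff]
      refine ⟨?_, fun h => by simpa using h.le⟩
      rintro rfl
      exact PointedCone.IsFaceOf.refl _
    | append_singleton l v ih =>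
      obtain ⟨h1, h2, h3⟩ := ih
      have hmem : ∀ w, w ∈ (redundantPart ⊥ l).reverse ++ (basisPart ⊥ l).reverse ↔
          w ∈ l.reverse := fun w => by
        rw [← List.reverse_append, List.mem_reverse, List.mem_reverse]
        exact mem_arrange
      have hspan : Submodule.span ℝ {w | w ∈ l.reverse} =
          Submodule.span ℝ {w | w ∈ (basisPart ⊥ l).reverse} := by
        refine le_antisymm (Submodule.span_le.2 fun w hw => h1 w (List.mem_reverse.1 hw))
          (Submodule.span_mono fun w hw => (hmem w).1 (List.mem_append_right _ hw))
      have hred : ∀ w ∈ (redundantPart ⊥ l).reverse,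
          w ∈ Submodule.span ℝ {w | w ∈ (basisPart ⊥ l).reverse} := fun w hw =>
        h1 w (List.mem_reverse.1 ((hmem w).1 (List.mem_append_left _ hw)))
      have hl : ({w | w ∈ l} : Set E) = {w | w ∈ l.reverse} := by simp
      rw [basisPart_concat, redundantPart_concat, bot_sup_eq, hl, List.reverse_append]
      by_cases hv : v ∈ Submodule.span ℝ {w | w ∈ l.reverse}
      · simp only [if_pos hv, List.reverse_nil, List.reverse_append, List.reverse_singleton,
          List.nil_append, List.cons_append]
        refine ⟨fun w hw => ?_, h2, ?_⟩
        · rcases List.mem_append.1 hw with hw | hw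
          · exact h1 w hw
          · rw [List.mem_singleton.1 hw, ← hspan]
            exact hv
        · rw [pyramidDecRev, pyramidRec, h3, cone_congr hmem]
          simp only [hv, not_true, false_and, true_and, false_or, and_assoc]
      · simp only [if_neg hv, List.append_nil, List.reverse_append, List.reverse_singleton,
          List.nil_append, List.cons_append]
        have hv' := hv
        rw [hspan] at hv'
        refine ⟨fun w hw => ?_, fun P => ?_, ?_⟩
        · rcases List.mem_append.1 hw with hw | hw
          · exact Submodule.span_mono (fun u hu => List.mem_cons_of_mem _ hu) (h1 w hw)
          · rw [List.mem_singleton.1 hw]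
            exact Submodule.subset_span List.mem_cons_self
        · -- without vectors in between, the swap lemma describes the pyramids of `v :: b`
          have := pyramidDecRev_append_cons (r := []) hv' (by simp) h2
          rw [List.nil_append, List.nil_append] at this
          rw [this, cone_cons, isFaceOf_coneOver_iff hv']
          simp only [Set.mem_union, Set.mem_ofPred_eq, h2]
        · rw [pyramidDecRev_append_cons hv' hred h2, h3, pyramidRec]
          simp only [hv, not_false_eq_true, false_and, true_and, or_false]
  rw [pyramidDec, arrange, List.reverse_append]
  exact key.2.2

/-! ### Iteration -/

theorem le_cone_of_mem_pyramidDec {l : List E} {P : PointedCone ℝ E} (h : P ∈ pyramidDec l) :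
    P ≤ cone l := by
  rw [pyramidDec_eq_pyramidRec] at h
  exact (le_cone_of_mem_pyramidRec h).trans (cone_mono fun v hv => List.mem_reverse.1 hv)

theorem le_cone_of_mem_pyramidIter {l : List E} {k : ℕ} {P : PointedCone ℝ E}
    (h : P ∈ pyramidIter l k) : P ≤ cone l := by
  cases k with
  | zero => exact le_cone_of_mem_pyramidDec h
  | succ k =>
    simp only [pyramidIter, Set.mem_iUnion] at h
    obtain ⟨Q, -, hP⟩ := h
    exact (le_cone_of_mem_pyramidDec hP).trans (cone_mono fun v hv => (mem_subsystem.1 hv).1)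

/-- The iteration can also be unfolded at its first step. -/
theorem pyramidIter_succ (l : List E) (k : ℕ) :
    pyramidIter l (k + 1) = ⋃ P ∈ pyramidDec l, pyramidIter (subsystem l P) k := by
  induction k with
  | zero => rfl
  | succ k ih =>
    rw [pyramidIter, ih]
    ext Q
    simp only [Set.mem_iUnion, pyramidIter, exists_prop]
    have hsub : ∀ P P', P' ∈ pyramidIter (subsystem l P) k →
        subsystem (subsystem l P) P' = subsystem l P' := fun P P' hP' =>
      subsystem_subsystem ((le_cone_of_mem_pyramidIter hP').trans (cone_subsystem_le l P))
    constructor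
    · rintro ⟨P', ⟨P, hP, hP'⟩, hQ⟩
      exact ⟨P, hP, P', hP', by rwa [hsub P P' hP']⟩
    · rintro ⟨P, hP, P', hP', hQ⟩
      exact ⟨P', ⟨P, hP, hP'⟩, by rwa [hsub P P' hP'] at hQ⟩

/-- The iteration has reached the lexicographic triangulation after as many steps as the excess of
the system, since each step lowers the excess of all the pyramids that occur. -/
theorem pyramidIter_eq_lexTriangulation {l : List E} {k : ℕ} (h : excess l.reverse ≤ k) :
    pyramidIter l k = lexTriangulation l := by
  induction k generalizing l with
  | zero =>
    rw [pyramidIter, pyramidDec_eq_pyramidRec,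
      pyramidRec_eq_lexTriangulationRev (Nat.le_zero.1 h), lexTriangulation]
  | succ k ih =>
    ext σ
    rw [pyramidIter_succ, lexTriangulation, mem_lexTriangulationRev_iff_exists_pyramidRec,
      pyramidDec_eq_pyramidRec]
    simp only [Set.mem_iUnion, exists_prop]
    refine exists_congr fun P => and_congr_right fun hP => ?_
    rw [ih, lexTriangulation, subsystem_reverse]
    rw [subsystem_reverse]
    have := excess_subsystem_of_mem_pyramidRec hP
    omega

/-- The vectors that do not enlarge the span number `n - d`, and only these count for the excess. -/
theorem excess_le_length_sub_coneDim (l : List E) :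
    excess l.reverse ≤ l.length - coneDim (cone l) := by
  have h := excess_add_finrank_le l.reverse
  have hs : Submodule.span ℝ (cone l : Set E) = Submodule.span ℝ {w | w ∈ l.reverse} :=
    le_antisymm
      (Submodule.span_le.2 fun w hw => by simpa using mem_span_of_mem_cone hw)
      (Submodule.span_mono fun w hw => mem_cone (List.mem_reverse.1 hw))
  rw [List.length_reverse, ← hs] at h
  rw [coneDim]
  omega

end PyramidDecomposition

end

open PyramidDecomposition in
theorem proposition2p4 {n d : ℕ} (x : Fin n → (Fin d → ℝ))
    (hC : coneDim (cone (List.ofFn x)) = d) :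
    pyramidTotal (List.ofFn x) = pyramidIter (List.ofFn x) (n - d) ∧
    pyramidIter (List.ofFn x) (n - d) = lexTriangulation (List.ofFn x) ∧
    ∀ k, n - d ≤ k → pyramidIter (List.ofFn x) k = pyramidIter (List.ofFn x) (n - d) := by
  have hstable : ∀ k, n - d ≤ k →
      pyramidIter (List.ofFn x) k = lexTriangulation (List.ofFn x) := by
    intro k hk
    refine pyramidIter_eq_lexTriangulation ((excess_le_length_sub_coneDim _).trans ?_)
    rwa [hC, List.length_ofFn]
  have h0 := hstable (n - d) le_rfl
  refine ⟨?_, h0, fun k hk => (hstable k hk).trans h0.symm⟩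
  ext P
  rw [h0]
  constructor
  · intro h
    obtain ⟨k, hP, hk⟩ := (Filter.Eventually.and h (Filter.eventually_ge_atTop (n - d))).exists
    rwa [hstable k hk] at hP
  · intro h
    filter_upwards [Filter.eventually_ge_atTop (n - d)] with k hk
    rwa [hstable k hk]
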